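/- Let $N\ge 1$ and $\sigma\in(0,2)$, and put $$\mu_\sigma=\frac{2^{\sigma-1}\Gamma(\sigma/2)}{\Gamma(1-\sigma/2)},\qquad P(x,y)=d_{N,\sigma}\,\frac{y^\sigma}{(|x|^2+y^2)^{(N+\sigma)/2}}\quad(x\in\mathbb R^N,\ y>0),$$ where $d_{N,\sigma}>0$ is the constant for which $\int_{\mathbb R^N}P(x,y)\,dx=1$; $P$ is the Poisson kernel of $L_\sigma=\nabla\cdot(y^{1-\sigma}\nabla)$ in the half space $y>0$. Let $g\in C^2(\mathbb R^N)$ be real-valued with $\int_{\mathbb R^N}|g(\xi)|\,(1+|\xi|^2)^{-(N+\sigma)/2}\,d\xi<\infty$, and let $v$ be its $\sigma$-harmonic (Poisson) extension, $$v(x,y)=\int_{\mathbb R^N}P(x-\xi,y)\,g(\xi)\,d\xi\quad(y>0),\qquad v(x,0)=g(x).$$ Let $F(x,y)=\sigma\,\dfrac{v(x,y)-v(x,0)}{y^\sigma}$ for $y>0$. Then for every $x\in\mathbb R^N$ the normalized $\sigma$-derivative $$\frac{\partial v}{\partial y^\sigma}(x,0):=\mu_\sigma\lim_{y\to0^+}y^{1-\sigma}\frac{\partial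 v}{\partial y}(x,y)$$ exists and equals $-(-\Delta)^{\sigma/2}g(x)$, where $$(-\Delta)^{\sigma/2}g(x)=C_{N,\sigma}\,\mathrm{P.V.}\!\int_{\mathbb R^N}\frac{g(x)-g(\xi)}{|x-\xi|^{N+\sigma}}\,d\xi,\qquad C_{N,\sigma}=\frac{2^{\sigma-1}\sigma\,\Gamma\left(\frac{N+\sigma}2\right)}{\pi^{N/2}\,\Gamma\left(1-\frac\sigma2\right)},$$ the principal value existing as well, and $$\Big|\mu_\sigma F(x,y)-\frac{\partial v}{\partial y^\sigma}(x,0)\Big|=O(y^{2-\sigma})$$ in the following sense. For every compact $K\subset\mathbb R^N$ there is a constant $A$ such that the left side is at most $A\,y^{2-\sigma}$ for all $x\in K$ and $y>0$. Moreover, there is a constant $C$, depending only on $N$ and $\sigma$, such that if $|g|\le M$ and $\|D^2g\|\le M$ on $\mathbb R^N$, then the left side is at most $C\,M\,y^{2-\sigma}$ for all $x\in\mathbb R^N$ and $y>0$. -/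

import Mathlib

open Set Filter Topology MeasureTheory

noncomputable section

namespace SigmaExtension

/-- The constant `μ_σ = 2^(σ-1) Γ(σ/2) / Γ(1-σ/2)`. -/
def mu (σ : ℝ) : ℝ :=
  2 ^ (σ - 1) * Real.Gamma (σ / 2) / Real.Gamma (1 - σ / 2)

/-- The constant `C_{N,σ} = 2^(σ-1) σ Γ((N+σ)/2) / (π^(N/2) Γ(1-σ/2))` of the fractional
Laplacian `(-Δ)^(σ/2)`. -/
def fracConst (N : ℕ) (σ : ℝ) : ℝ :=
  2 ^ (σ - 1) * σ * Real.Gamma (((N : ℝ) + σ) / 2) /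
    (Real.pi ^ ((N : ℝ) / 2) * Real.Gamma (1 - σ / 2))

/-- The constant `d_{N,σ}`, which normalizes the Poisson kernel to have integral one:
`1 / d_{N,σ} = ∫ (|z|² + 1)^(-(N+σ)/2) dz`. -/
def poissonConst (N : ℕ) (σ : ℝ) : ℝ :=
  (∫ z : EuclideanSpace ℝ (Fin N), 1 / (‖z‖ ^ 2 + 1) ^ (((N : ℝ) + σ) / 2))⁻¹

/-- The Poisson kernel `P(x,y) = d_{N,σ} y^σ / (|x|² + y²)^((N+σ)/2)` of
`L_σ = ∇ · (y^(1-σ) ∇)` in the half space `y > 0`. -/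
def poissonKernel {N : ℕ} (σ : ℝ) (x : EuclideanSpace ℝ (Fin N)) (y : ℝ) : ℝ :=
  poissonConst N σ * (y ^ σ / (‖x‖ ^ 2 + y ^ 2) ^ (((N : ℝ) + σ) / 2))

/-- The `σ`-harmonic extension of `g`: the Poisson integral of `g` for `y > 0`, and `g` itself
at `y = 0`. -/
def extension {N : ℕ} (σ : ℝ) (g : EuclideanSpace ℝ (Fin N) → ℝ)
    (x : EuclideanSpace ℝ (Fin N)) (y : ℝ) : ℝ :=
  if 0 < y then ∫ ξ, poissonKernel σ (x - ξ) y * g ξ else g x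

/-- The two-point discretization `F(x,y) = σ (v(x,y) - v(x,0)) / y^σ`. -/
def twoPoint {N : ℕ} (σ : ℝ) (v : EuclideanSpace ℝ (Fin N) → ℝ → ℝ)
    (x : EuclideanSpace ℝ (Fin N)) (y : ℝ) : ℝ :=
  σ * ((v x y - v x 0) / y ^ σ)

/-- The normalized `σ`-derivative `∂v/∂y^σ (x,0) = μ_σ lim_{y → 0+} y^(1-σ) ∂v/∂y (x,y)` exists
and equals `L`. -/
def HasSigmaDeriv {N : ℕ} (σ : ℝ) (v : EuclideanSpace ℝ (Fin N) → ℝ → ℝ)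
    (x : EuclideanSpace ℝ (Fin N)) (L : ℝ) : Prop :=
  (∀ y : ℝ, 0 < y → DifferentiableAt ℝ (v x) y) ∧
    Tendsto (fun y : ℝ => mu σ * (y ^ (1 - σ) * deriv (v x) y)) (𝓝[>] 0) (𝓝 L)

/-- `(-Δ)^(σ/2) g (x) = C_{N,σ} P.V. ∫ (g(x) - g(ξ)) / |x - ξ|^(N+σ) dξ` exists and equals `L`:
the integrals outside the balls of radius `ε` around `x` converge absolutely, and their limit
as `ε → 0+`, times the constant, is `L`. -/
def HasFracLaplacian {N : ℕ} (σ : ℝ) (g : EuclideanSpace ℝ (Fin N) → ℝ)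
    (x : EuclideanSpace ℝ (Fin N)) (L : ℝ) : Prop :=
  (∀ ε : ℝ, 0 < ε →
      IntegrableOn (fun ξ => (g x - g ξ) / ‖x - ξ‖ ^ ((N : ℝ) + σ)) {ξ | ε < ‖x - ξ‖}) ∧
    Tendsto
      (fun ε : ℝ => fracConst N σ *
        ∫ ξ in {ξ | ε < ‖x - ξ‖}, (g x - g ξ) / ‖x - ξ‖ ^ ((N : ℝ) + σ))
      (𝓝[>] 0) (𝓝 L)

end SigmaExtension

end

/-! Write q = (N+σ)/2, k_y(z) = (|z|²+y²)^(-q) and δ(z) = g(x+z) + g(x-z) - 2g(x). Since the Poisson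
kernel is even with mass one, v(x,y) - g(x) = (d/2) y^σ I(y) with I(y) = ∫ δ k_y (`extension_eq`).
Thus F is exactly (σd/2) I(y), and μσd = C_{N,σ} by a Gamma computation, so everything reduces to
comparing I(y) with I(0), which converges absolutely because δ = O(|z|²) at 0 and g is integrable
against the weight at infinity.

The rate comes from |z|²(k_0 - k_y) ≤ (1+q) min(|z|², y²) k_0 (`radialKernel_zero_sub_le`): the
integral of the right side scales exactly like y^(2-σ). A global quadratic bound on δ gives the
uniform estimate. With a bound only for |z| ≤ 1, the remaining part is a convergent tail that
absorbs the same power of y.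

For the derivative, y^(1-σ) ∂_y v = (d/2)(σ I(y) + y I'(y)), where y I'(y) → 0 by dominated
convergence. Truncating k_0 to |z| > ε keeps it even, so the principal value is also a multiple of
I(0). -/

namespace SigmaExtension

/-- The radial kernel `(|z|² + y²)^(-q)`. -/
noncomputable def radialKernel {N : ℕ} (q y : ℝ) (z : EuclideanSpace ℝ (Fin N)) : ℝ :=
  ((‖z‖ ^ 2 + y ^ 2) ^ q)⁻¹

/-! ### The radial kernel: normalization, scaling, integrability, comparison -/

section Kernel

variable {N : ℕ} {q y : ℝ}

theorem radialKernel_nonneg (z : EuclideanSpace ℝ (Fin N)) : 0 ≤ radialKernel q y z := by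
  unfold radialKernel; positivity

theorem radialKernel_neg (z : EuclideanSpace ℝ (Fin N)) :
    radialKernel q y (-z) = radialKernel q y z := by
  simp [radialKernel]

theorem measurable_radialKernel :
    Measurable (radialKernel q y : EuclideanSpace ℝ (Fin N) → ℝ) := by
  unfold radialKernel; fun_prop

theorem radialKernel_zero (z : EuclideanSpace ℝ (Fin N)) :
    radialKernel q 0 z = (‖z‖ ^ (2 * q))⁻¹ := by
  rw [radialKernel, Real.rpow_mul (norm_nonneg z)]
  norm_num

theorem radialKernel_le (hq : 0 < q) {z : EuclideanSpace ℝ (Fin N)} (hz : z ≠ 0) :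
    radialKernel q y z ≤ radialKernel q 0 z := by
  have : 0 < ‖z‖ := norm_pos_iff.2 hz
  unfold radialKernel
  refine inv_anti₀ (by positivity) (Real.rpow_le_rpow (by positivity) ?_ hq.le)
  linarith [sq_nonneg y]

theorem integrable_radialKernel_one (hq : (N : ℝ) < 2 * q) :
    Integrable (radialKernel q 1 : EuclideanSpace ℝ (Fin N) → ℝ) := by
  have h := integrable_rpow_neg_one_add_norm_sq (E := EuclideanSpace ℝ (Fin N)) (μ := volume)
    (r := 2 * q) (by simpa using hq)
  refine h.congr (ae_of_all _ fun z => ?_)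
  simp only [radialKernel]
  rw [show -(2 * q) / 2 = -q by ring, Real.rpow_neg (by positivity), add_comm, one_pow]

/-- The integral `∫ (|z|² + 1)^(-(N+σ)/2) dz`, computed from the Gamma integral. -/
theorem integral_radialKernel_one {σ : ℝ} (hσ : 0 < σ) :
    ∫ z : EuclideanSpace ℝ (Fin N), radialKernel ((N + σ) / 2) 1 z =
      Real.pi ^ ((N : ℝ) / 2) * Real.Gamma (σ / 2) / Real.Gamma ((N + σ) / 2) := by
  set q : ℝ := (N + σ) / 2 with hq
  have hq0 : 0 < q := by positivity
  have hG : 0 < Real.Gamma q := Real.Gamma_pos_of_pos hq0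
  -- Integrating f in t gives Γ(q) times the kernel; integrating in z first gives a Gaussian
  -- integral, then Γ(σ/2). Fubini equates the two.
  let f : EuclideanSpace ℝ (Fin N) → ℝ → ℝ := fun z t =>
    t ^ (q - 1) * Real.exp (-((‖z‖ ^ 2 + 1) * t))
  have hinner : ∀ z, ∫ t in Ioi 0, f z t = Real.Gamma q * radialKernel q 1 z := fun z => by
    rw [Real.integral_rpow_mul_exp_neg_mul_Ioi hq0 (by positivity), radialKernel, one_div,
      Real.inv_rpow (by positivity), one_pow, mul_comm]
  have hker : ∀ z : EuclideanSpace ℝ (Fin N), 0 < radialKernel q 1 z := fun z => by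
    unfold radialKernel; positivity
  have hnn : ∀ z, ∀ t ∈ Ioi (0 : ℝ), 0 ≤ f z t := fun z t ht => by
    have : (0 : ℝ) < t := ht
    positivity
  have hint : ∀ z, Integrable (f z) (volume.restrict (Ioi 0)) := fun z => by
    -- A non-integrable function has Bochner integral 0 by convention, so a nonzero value forces
    -- integrability.
    apply Integrable.of_integral_ne_zero
    rw [hinner]
    exact (mul_pos hG (hker z)).ne'
  have hprod : Integrable (Function.uncurry f) (volume.prod (volume.restrict (Ioi 0))) := by
    rw [integrable_prod_iff]
    · refine ⟨ae_of_all _ hint, ?_⟩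
      refine ((integrable_radialKernel_one (N := N) (q := q) (by linarith)).const_mul
        (Real.Gamma q)).congr (ae_of_all _ fun z => ?_)
      dsimp only
      rw [← hinner]
      refine setIntegral_congr_fun measurableSet_Ioi fun t ht => ?_
      exact (Real.norm_of_nonneg (hnn z t ht)).symm
    · apply Measurable.aestronglyMeasurable
      simp only [f, Function.uncurry_def]
      fun_prop
  have hswap := integral_integral_swap hprod
  simp only [hinner] at hswap
  rw [integral_const_mul] at hswap
  have hgauss : ∀ t ∈ Ioi (0 : ℝ), ∫ z, f z t =
      Real.pi ^ ((N : ℝ) / 2) * (t ^ (σ / 2 - 1) * Real.exp (-(1 * t))) := fun t ht => by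
    have ht' : (0 : ℝ) < t := ht
    have : ∀ z, f z t = t ^ (q - 1) * Real.exp (-t) * Real.exp (-t * ‖z‖ ^ 2) := fun z => by
      simp only [f]
      rw [mul_assoc, ← Real.exp_add]
      ring_nf
    simp only [this]
    rw [integral_const_mul, GaussianFourier.integral_rexp_neg_mul_sq_norm ht',
      finrank_euclideanSpace_fin, Real.div_rpow Real.pi_pos.le ht'.le,
      show q - 1 = (σ / 2 - 1) + (N : ℝ) / 2 by rw [hq]; ring, Real.rpow_add ht', one_mul]
    have : t ^ ((N : ℝ) / 2) ≠ 0 := by positivity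
    field_simp
  rw [setIntegral_congr_fun measurableSet_Ioi hgauss, integral_const_mul,
    Real.integral_rpow_mul_exp_neg_mul_Ioi (by positivity) one_pos] at hswap
  rw [eq_div_iff hG.ne', mul_comm, hswap]
  simp

/-- The factor Γ(σ/2) in μ_σ cancels the one in 1/d_{N,σ}. -/
theorem mu_mul_poissonConst {σ : ℝ} (hσ : 0 < σ) :
    mu σ * (σ * poissonConst N σ) = fracConst N σ := by
  have h := integral_radialKernel_one (N := N) hσ
  simp only [radialKernel, one_pow] at h
  have h1 : 0 < Real.Gamma (σ / 2) := Real.Gamma_pos_of_pos (by positivity)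
  have h2 : 0 < Real.Gamma ((N + σ) / 2) := Real.Gamma_pos_of_pos (by positivity)
  have h3 : 0 < Real.pi ^ ((N : ℝ) / 2) := by positivity
  simp only [mu, poissonConst, fracConst, one_div, h]
  field_simp

theorem poissonConst_mul_integral {σ : ℝ} (hσ : 0 < σ) :
    poissonConst N σ * ∫ z : EuclideanSpace ℝ (Fin N), radialKernel ((N + σ) / 2) 1 z = 1 := by
  have h1 : 0 < Real.Gamma (σ / 2) := Real.Gamma_pos_of_pos (by positivity)
  have h2 : 0 < Real.Gamma ((N + σ) / 2) := Real.Gamma_pos_of_pos (by positivity)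
  have h := integral_radialKernel_one (N := N) hσ
  have : poissonConst N σ =
      (∫ z : EuclideanSpace ℝ (Fin N), radialKernel ((N + σ) / 2) 1 z)⁻¹ := by
    simp [poissonConst, radialKernel]
  rw [this, inv_mul_cancel₀]
  rw [h]
  positivity

/-- Under dilations the kernel is homogeneous of degree `-2q`. -/
theorem radialKernel_smul {t : ℝ} (ht : 0 < t) (z : EuclideanSpace ℝ (Fin N)) :
    radialKernel q (t * y) (t • z) = t ^ (-(2 * q)) * radialKernel q y z := by
  have : ‖t • z‖ ^ 2 + (t * y) ^ 2 = t ^ 2 * (‖z‖ ^ 2 + y ^ 2) := by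
    rw [norm_smul, Real.norm_of_nonneg ht.le]; ring
  rw [radialKernel, this, Real.mul_rpow (by positivity) (by positivity), mul_inv,
    ← Real.rpow_natCast, ← Real.rpow_mul ht.le, Real.rpow_neg ht.le, radialKernel]
  norm_num

theorem integral_dilation (f : EuclideanSpace ℝ (Fin N) → ℝ) {t : ℝ} (ht : 0 < t) :
    ∫ z, f z = t ^ (N : ℝ) * ∫ z, f (t • z) := by
  rw [Measure.integral_comp_smul_of_nonneg volume f t (hR := ht.le), finrank_euclideanSpace_fin,
    smul_eq_mul, Real.rpow_natCast, mul_inv_cancel_left₀ (by positivity)]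

/-- The Poisson kernel has integral one. -/
theorem poissonConst_mul_rpow_mul_integral {σ : ℝ} (hσ : 0 < σ) (hy : 0 < y) :
    poissonConst N σ * y ^ σ *
      ∫ z : EuclideanSpace ℝ (Fin N), radialKernel ((N + σ) / 2) y z = 1 := by
  rw [integral_dilation _ hy]
  have h : ∀ z : EuclideanSpace ℝ (Fin N), radialKernel ((N + σ) / 2) y (y • z) =
      y ^ (-(2 * ((N + σ) / 2))) * radialKernel ((N + σ) / 2) 1 z := fun z => by
    rw [← radialKernel_smul hy, mul_one]
  simp only [h]
  rw [integral_const_mul]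
  have h2 : y ^ σ * y ^ (N : ℝ) * y ^ (-(2 * ((N + σ) / 2))) = 1 := by
    rw [← Real.rpow_add hy, ← Real.rpow_add hy]
    ring_nf
    simp
  linear_combination (poissonConst_mul_integral (N := N) hσ) +
    (poissonConst N σ * ∫ z : EuclideanSpace ℝ (Fin N), radialKernel ((N + σ) / 2) 1 z) * h2

/-- The function `min(|z|², 1) |z|^(-(N+σ))` is integrable for `0 < σ < 2`. -/
theorem integrable_min_sq_mul_radialKernel (hN : 1 ≤ N) {σ : ℝ} (hσ : σ ∈ Ioo (0 : ℝ) 2) :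
    Integrable (fun z : EuclideanSpace ℝ (Fin N) =>
      min (‖z‖ ^ 2) 1 * radialKernel ((N + σ) / 2) 0 z) := by
  have : Nonempty (Fin N) := ⟨⟨0, hN⟩⟩
  obtain ⟨h0, h2⟩ := hσ
  simp only [radialKernel_zero]
  refine (integrable_fun_norm_addHaar volume
    (f := fun r : ℝ => min (r ^ 2) 1 * (r ^ (2 * ((N + σ) / 2)))⁻¹)).2 ?_
  rw [finrank_euclideanSpace_fin, ← Ioc_union_Ioi_eq_Ioi zero_le_one]
  have key : ∀ r : ℝ, 0 < r →
      r ^ (N - 1) * (r ^ (2 * ((N + σ) / 2)))⁻¹ = r ^ (-1 - σ) := fun r hr => by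
    rw [← Real.rpow_neg hr.le, ← Real.rpow_natCast, ← Real.rpow_add hr, Nat.cast_sub hN]
    congr 1
    push_cast; ring
  -- The radial integrand is r^(1-σ) on (0,1], integrable as σ < 2, and r^(-1-σ) beyond, integrable
  -- as σ > 0.
  refine IntegrableOn.union ?_ ?_
  · have h := (intervalIntegral.intervalIntegrable_rpow' (a := 0) (b := 1) (r := 1 - σ)
      (by linarith))
    rw [intervalIntegrable_iff_integrableOn_Ioc_of_le zero_le_one] at h
    refine h.congr_fun (fun r hr => ?_) measurableSet_Ioc
    have : r ^ 2 ≤ 1 := pow_le_one₀ hr.1.le hr.2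
    simp only [smul_eq_mul]
    rw [min_eq_left this, mul_left_comm, key r hr.1, ← Real.rpow_natCast, ← Real.rpow_add hr.1]
    congr 1
    push_cast; ring
  · refine (integrableOn_Ioi_rpow_of_lt (a := -1 - σ) (by linarith) one_pos).congr_fun
      (fun r hr => ?_) measurableSet_Ioi
    have hr1 : (1 : ℝ) < r := hr
    have : 1 ≤ r ^ 2 := one_le_pow₀ hr1.le
    simp only [smul_eq_mul]
    rw [min_eq_right this, one_mul, key r (by linarith)]

theorem min_sq_mul_radialKernel_smul {σ : ℝ} (hy : 0 < y) (z : EuclideanSpace ℝ (Fin N)) :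
    min (‖y • z‖ ^ 2) (y ^ 2) * radialKernel ((N + σ) / 2) 0 (y • z) =
      y ^ (2 - σ - N) * (min (‖z‖ ^ 2) 1 * radialKernel ((N + σ) / 2) 0 z) := by
  have h1 : min (‖y • z‖ ^ 2) (y ^ 2) = y ^ 2 * min (‖z‖ ^ 2) 1 := by
    rw [norm_smul, Real.norm_of_nonneg hy.le, mul_pow, mul_min_of_nonneg _ _ (sq_nonneg y), mul_one]
  have h2 : radialKernel ((N + σ) / 2) 0 (y • z) =
      y ^ (-(2 * ((N + σ) / 2))) * radialKernel ((N + σ) / 2) 0 z := by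
    rw [← radialKernel_smul hy, mul_zero]
  have h3 : y ^ (2 - σ - N) = y ^ 2 * y ^ (-(2 * ((N + σ) / 2))) := by
    rw [← Real.rpow_natCast, ← Real.rpow_add hy]
    congr 1
    push_cast; ring
  rw [h1, h2, h3]
  ring

theorem integrable_min_sq_mul_radialKernel_of_pos (hN : 1 ≤ N) {σ : ℝ}
    (hσ : σ ∈ Ioo (0 : ℝ) 2) (hy : 0 < y) :
    Integrable (fun z : EuclideanSpace ℝ (Fin N) =>
      min (‖z‖ ^ 2) (y ^ 2) * radialKernel ((N + σ) / 2) 0 z) := by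
  rw [← integrable_comp_smul_iff volume _ hy.ne']
  simp only [min_sq_mul_radialKernel_smul hy]
  exact (integrable_min_sq_mul_radialKernel hN hσ).const_mul _

/-- Source of the rate: under z = y w the factors are y² from the minimum, y^(-(N+σ)) from the
kernel and y^N from the volume. -/
theorem integral_min_sq_mul_radialKernel {σ : ℝ} (hy : 0 < y) :
    ∫ z : EuclideanSpace ℝ (Fin N), min (‖z‖ ^ 2) (y ^ 2) * radialKernel ((N + σ) / 2) 0 z =
      y ^ (2 - σ) *
        ∫ z : EuclideanSpace ℝ (Fin N), min (‖z‖ ^ 2) 1 * radialKernel ((N + σ) / 2) 0 z := by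
  rw [integral_dilation _ hy]
  simp only [min_sq_mul_radialKernel_smul hy]
  rw [integral_const_mul, ← mul_assoc, ← Real.rpow_add hy]
  ring_nf

/-- The difference of the singular kernel and its regularization. -/
theorem radialKernel_zero_sub_le (hq : 0 < q) {z : EuclideanSpace ℝ (Fin N)} (hz : z ≠ 0) :
    ‖z‖ ^ 2 * (radialKernel q 0 z - radialKernel q y z) ≤
      (1 + q) * (min (‖z‖ ^ 2) (y ^ 2) * radialKernel q 0 z) := by
  have hz' : 0 < ‖z‖ ^ 2 := by
    have := norm_pos_iff.2 hz
    positivity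
  set s := ‖z‖ ^ 2 with hs
  set u := y ^ 2 / s with hu
  have hu0 : 0 ≤ u := by positivity
  have hk0 := radialKernel_nonneg (q := q) (y := 0) z
  have hk1 := radialKernel_nonneg (q := q) (y := y) z
  have hy2 : y ^ 2 = s * u := by rw [hu]; field_simp
  have hfac : radialKernel q y z = radialKernel q 0 z * (1 + u) ^ (-q) := by
    rw [radialKernel, radialKernel, ← hs, hy2, show s + s * u = s * (1 + u) by ring,
      Real.mul_rpow hz'.le (by positivity), mul_inv, Real.rpow_neg (by positivity)]
    simp
  -- Bernoulli's inequality for a negative exponent, from e^t ≥ 1 + t and log(1+u) ≤ u.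
  have hbern : 1 - q * u ≤ (1 + u) ^ (-q) := by
    rw [Real.rpow_def_of_pos (by positivity)]
    have h1 := Real.add_one_le_exp (Real.log (1 + u) * -q)
    have h2 := Real.log_le_sub_one_of_pos (show 0 < 1 + u by positivity)
    nlinarith
  rw [mul_left_comm]
  -- For |z|² ≤ y² it suffices to drop k_y (constant 1); otherwise Bernoulli gives constant q. The
  -- factor 1 + q covers both.
  rcases min_cases s (y ^ 2) with ⟨h, -⟩ | ⟨h, -⟩ <;> rw [h]
  · have h3 : s * (radialKernel q 0 z - radialKernel q y z) ≤ s * radialKernel q 0 z := by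
      gcongr; linarith
    nlinarith [mul_nonneg hq.le (mul_nonneg hz'.le hk0)]
  · have h4 : radialKernel q 0 z - radialKernel q y z ≤ radialKernel q 0 z * (q * u) := by
      rw [hfac]; nlinarith
    have h5 : s * (radialKernel q 0 z - radialKernel q y z) ≤
        s * (radialKernel q 0 z * (q * u)) := by gcongr
    rw [hy2]
    nlinarith [mul_nonneg (mul_nonneg hz'.le hu0) hk0]

end Kernel

/-- The symmetric second difference `g(x+z) + g(x-z) - 2 g(x)`. -/
def secondDiff {N : ℕ} (g : EuclideanSpace ℝ (Fin N) → ℝ) (x z : EuclideanSpace ℝ (Fin N)) : ℝ :=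
  g (x + z) + g (x - z) - 2 * g x

/-! ### Second differences and their integrals against even kernels -/

section SecondDiff

variable {N : ℕ} {q y : ℝ} {g : EuclideanSpace ℝ (Fin N) → ℝ} {x : EuclideanSpace ℝ (Fin N)}

theorem secondDiff_zero : secondDiff g x 0 = 0 := by
  simp [secondDiff]; ring

theorem measurable_secondDiff (hg : Continuous g) : Measurable (secondDiff g x) := by
  have : Continuous (secondDiff g x) := by unfold secondDiff; fun_prop
  exact this.measurable

/-- Mean value inequality for t ↦ g(x+tz) + g(x-tz) on [0,1]: its derivative is a difference of Dg
at points at most 2|z| apart, applied to z. Bounding it by its supremum costs the factor 2. -/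
theorem abs_secondDiff_le {M : ℝ} (hg : ContDiff ℝ 2 g) {z : EuclideanSpace ℝ (Fin N)}
    (hM : ∀ w ∈ Metric.closedBall x ‖z‖, ‖iteratedFDeriv ℝ 2 g w‖ ≤ M) :
    |secondDiff g x z| ≤ 2 * M * ‖z‖ ^ 2 := by
  have hd : Differentiable ℝ g := hg.differentiable (by norm_num)
  have hd' : Differentiable ℝ (fderiv ℝ g) :=
    (hg.fderiv_right (m := 1) (by norm_num)).differentiable (by norm_num)
  have hmem : ∀ t ∈ Icc (-1 : ℝ) 1, x + t • z ∈ Metric.closedBall x ‖z‖ := fun t ht => by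
    rw [mem_closedBall_iff_norm, add_sub_cancel_left, norm_smul]
    exact mul_le_of_le_one_left (norm_nonneg z) (abs_le.2 ht)
  have hM' : ∀ w ∈ Metric.closedBall x ‖z‖, ‖fderiv ℝ (fderiv ℝ g) w‖ ≤ M := fun w hw => by
    rw [← norm_iteratedFDeriv_one, norm_iteratedFDeriv_fderiv]
    exact hM w hw
  have hM0 : 0 ≤ M := (norm_nonneg _).trans (hM x (by simp))
  have hφ : ∀ t : ℝ, HasDerivAt (fun t : ℝ => g (x + t • z) + g (x + (-t) • z))
      (fderiv ℝ g (x + t • z) z - fderiv ℝ g (x + (-t) • z) z) t := fun t => by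
    have h1 : HasDerivAt (fun t : ℝ => x + t • z) z t := by
      simpa using ((hasDerivAt_id t).smul_const z).const_add x
    have h2 : HasDerivAt (fun t : ℝ => x + (-t) • z) (-z) t := by
      simpa using ((hasDerivAt_id t).neg.smul_const z).const_add x
    have h3 := (hd (x + t • z)).hasFDerivAt.comp_hasDerivAt t h1
    have h4 := (hd (x + (-t) • z)).hasFDerivAt.comp_hasDerivAt t h2
    convert! h3.add h4 using 1
    simp [sub_eq_add_neg]
  have hbound : ∀ t ∈ Icc (0 : ℝ) 1,
      ‖fderiv ℝ g (x + t • z) z - fderiv ℝ g (x + (-t) • z) z‖ ≤ 2 * M * ‖z‖ ^ 2 := fun t ht => by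
    have h1 := (convex_closedBall x ‖z‖).norm_image_sub_le_of_norm_fderiv_le (𝕜 := ℝ)
      (fun w _ => hd' w) hM' (hmem (-t) ⟨by linarith [ht.2], by linarith [ht.1]⟩)
      (hmem t ⟨by linarith [ht.1], ht.2⟩)
    have h2 : ‖(x + t • z) - (x + (-t) • z)‖ ≤ 2 * ‖z‖ := by
      rw [show (x + t • z) - (x + (-t) • z) = (2 * t) • z by module, norm_smul,
        Real.norm_of_nonneg (by linarith [ht.1])]
      exact mul_le_mul_of_nonneg_right (by linarith [ht.2]) (norm_nonneg z)
    rw [← sub_apply]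
    calc _ ≤ ‖fderiv ℝ g (x + t • z) - fderiv ℝ g (x + (-t) • z)‖ * ‖z‖ :=
          ContinuousLinearMap.le_opNorm _ _
      _ ≤ (M * (2 * ‖z‖)) * ‖z‖ := by gcongr; exact h1.trans (by gcongr)
      _ = _ := by ring
  have h := (convex_Icc (0 : ℝ) 1).norm_image_sub_le_of_norm_hasDerivWithin_le
    (fun t _ => (hφ t).hasDerivWithinAt) hbound (left_mem_Icc.2 zero_le_one)
    (right_mem_Icc.2 zero_le_one)
  have heq : secondDiff g x z = g (x + (1 : ℝ) • z) + g (x + (-1 : ℝ) • z) -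
      (g (x + (0 : ℝ) • z) + g (x + (-0 : ℝ) • z)) := by
    simp [secondDiff, sub_eq_add_neg]; ring
  rw [heq, ← Real.norm_eq_abs]
  simpa using h

/-- Use |x+z|² ≤ 2|x|² + 2|z|² and absorb the constants through |z|² + y² ≥ a. Kernels centred at x
are thereby controlled by the fixed weight in the hypothesis on g. -/
theorem radialKernel_le_translate (hq : 0 < q) {a : ℝ} (ha : 0 < a)
    (x : EuclideanSpace ℝ (Fin N)) {z : EuclideanSpace ℝ (Fin N)} (hz : a ≤ ‖z‖ ^ 2 + y ^ 2) :
    radialKernel q y z ≤ (2 + (2 * ‖x‖ ^ 2 + 1) / a) ^ q * radialKernel q 1 (x + z) := by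
  have hs : 0 < ‖z‖ ^ 2 + y ^ 2 := ha.trans_le hz
  have h1 : ‖x + z‖ ^ 2 + 1 ^ 2 ≤ (2 + (2 * ‖x‖ ^ 2 + 1) / a) * (‖z‖ ^ 2 + y ^ 2) := by
    have h2 : ‖x + z‖ ^ 2 ≤ (‖x‖ + ‖z‖) ^ 2 := by gcongr; exact norm_add_le x z
    have h3 : 2 * ‖x‖ ^ 2 + 1 ≤ (2 * ‖x‖ ^ 2 + 1) / a * (‖z‖ ^ 2 + y ^ 2) := by
      rw [div_mul_eq_mul_div, le_div_iff₀ ha]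
      gcongr
    nlinarith [sq_nonneg (‖x‖ - ‖z‖), sq_nonneg y]
  unfold radialKernel
  rw [← div_eq_mul_inv, le_div_iff₀ (by positivity), inv_mul_le_iff₀ (by positivity), mul_comm,
    ← Real.mul_rpow (by positivity) hs.le]
  exact Real.rpow_le_rpow (by positivity) h1 hq.le

/-- An even nonnegative kernel dominated by `(|x + z|² + 1)^(-q)`. -/
structure IsDominatedKernel (q c : ℝ) (x : EuclideanSpace ℝ (Fin N))
    (k : EuclideanSpace ℝ (Fin N) → ℝ) : Prop where
  measurable : Measurable k
  even : ∀ z, k (-z) = k z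
  nonneg : ∀ z, 0 ≤ k z
  le : ∀ z, k z ≤ c * radialKernel q 1 (x + z)

theorem isDominatedKernel_radialKernel (hq : 0 < q) (hy : 0 < y)
    (x : EuclideanSpace ℝ (Fin N)) :
    IsDominatedKernel q ((2 + (2 * ‖x‖ ^ 2 + 1) / y ^ 2) ^ q) x (radialKernel q y) where
  measurable := measurable_radialKernel
  even := radialKernel_neg
  nonneg := radialKernel_nonneg
  le z := radialKernel_le_translate hq (by positivity) x (by linarith [sq_nonneg ‖z‖])

theorem isDominatedKernel_indicator (hq : 0 < q) {ε : ℝ} (hε : 0 < ε)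
    (x : EuclideanSpace ℝ (Fin N)) :
    IsDominatedKernel q ((2 + (2 * ‖x‖ ^ 2 + 1) / ε ^ 2) ^ q) x
      ({z | ε < ‖z‖}.indicator (radialKernel q 0)) where
  measurable := measurable_radialKernel.indicator
    (measurableSet_lt measurable_const measurable_norm)
  even z := by simp [indicator, radialKernel_neg]
  nonneg := indicator_nonneg fun z _ => radialKernel_nonneg z
  le z := by
    refine indicator_apply_le' (fun hz => ?_) fun _ =>
      mul_nonneg (by positivity) (radialKernel_nonneg _)
    have hz' : ε < ‖z‖ := hz
    exact radialKernel_le_translate hq (by positivity) x (by nlinarith)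

namespace IsDominatedKernel

variable {c : ℝ} {k : EuclideanSpace ℝ (Fin N) → ℝ}

theorem integrable (hk : IsDominatedKernel q c x k) (hq : (N : ℝ) < 2 * q) : Integrable k := by
  refine Integrable.mono' (((integrable_radialKernel_one hq).comp_add_left x).const_mul c)
    hk.measurable.aestronglyMeasurable (ae_of_all _ fun z => ?_)
  rw [Real.norm_of_nonneg (hk.nonneg z)]
  exact hk.le z

theorem abs_mul_le (hk : IsDominatedKernel q c x k) (z : EuclideanSpace ℝ (Fin N)) :
    |g (x + z)| * k z ≤ c * |g (x + z) * radialKernel q 1 (x + z)| := by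
  rw [abs_mul, abs_of_nonneg (radialKernel_nonneg _), mul_left_comm]
  exact mul_le_mul_of_nonneg_left (hk.le z) (abs_nonneg _)

theorem integrable_mul (hk : IsDominatedKernel q c x k) (hg : Continuous g)
    (hgi : Integrable fun ξ => g ξ * radialKernel q 1 ξ) :
    Integrable fun z => g (x + z) * k z := by
  refine Integrable.mono' ((hgi.abs.comp_add_left x).const_mul c)
    (Measurable.aestronglyMeasurable ?_) (ae_of_all _ fun z => ?_)
  · exact (hg.comp (by fun_prop)).measurable.mul hk.measurable
  · rw [norm_mul, Real.norm_of_nonneg (hk.nonneg z), Real.norm_eq_abs]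
    exact hk.abs_mul_le z

theorem integrable_mul_neg (hk : IsDominatedKernel q c x k) (hg : Continuous g)
    (hgi : Integrable fun ξ => g ξ * radialKernel q 1 ξ) :
    Integrable fun z => g (x - z) * k z := by
  refine (hk.integrable_mul hg hgi).comp_neg.congr (ae_of_all _ fun z => ?_)
  simp [hk.even, sub_eq_add_neg]

theorem integrable_sub_mul (hk : IsDominatedKernel q c x k) (hq : (N : ℝ) < 2 * q)
    (hg : Continuous g) (hgi : Integrable fun ξ => g ξ * radialKernel q 1 ξ) :
    Integrable fun z => (g (x + z) - g x) * k z := by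
  simp only [sub_mul]
  exact (hk.integrable_mul hg hgi).sub ((hk.integrable hq).const_mul _)

theorem integrable_secondDiff_mul (hk : IsDominatedKernel q c x k) (hq : (N : ℝ) < 2 * q)
    (hg : Continuous g) (hgi : Integrable fun ξ => g ξ * radialKernel q 1 ξ) :
    Integrable fun z => secondDiff g x z * k z := by
  simp only [secondDiff, sub_mul, add_mul]
  exact ((hk.integrable_mul hg hgi).add (hk.integrable_mul_neg hg hgi)).sub
    ((hk.integrable hq).const_mul _)

/-- Evenness of k allows averaging over z and -z, which cancels the first-order part of g. -/
theorem integral_secondDiff_mul (hk : IsDominatedKernel q c x k) (hq : (N : ℝ) < 2 * q)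
    (hg : Continuous g) (hgi : Integrable fun ξ => g ξ * radialKernel q 1 ξ) :
    ∫ z, secondDiff g x z * k z = 2 * ∫ z, (g (x + z) - g x) * k z := by
  have h := hk.integrable_sub_mul hq hg hgi
  have h1 : ∫ z, (g (x + -z) - g x) * k (-z) = ∫ z, (g (x + z) - g x) * k z :=
    integral_neg_eq_self (fun z => (g (x + z) - g x) * k z) volume
  rw [two_mul]
  nth_rewrite 2 [← h1]
  rw [← integral_add h h.comp_neg]
  congr 1 with z
  rw [hk.even, secondDiff, sub_eq_add_neg x z]
  ring

/-- The bound involves x only through c and |g x|, hence is uniform on compact sets when c is. -/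
theorem integral_abs_secondDiff_mul_le (hk : IsDominatedKernel q c x k) (hq : (N : ℝ) < 2 * q)
    (hg : Continuous g) (hgi : Integrable fun ξ => g ξ * radialKernel q 1 ξ) :
    ∫ z, |secondDiff g x z| * k z ≤
      2 * c * ((∫ ξ, |g ξ * radialKernel q 1 ξ|) +
        |g x| * ∫ ξ : EuclideanSpace ℝ (Fin N), radialKernel q 1 ξ) := by
  have hi : Integrable fun z => |g (x + z)| * k z :=
    (hk.integrable_mul hg hgi).abs.congr
      (ae_of_all _ fun z => by simp [abs_mul, abs_of_nonneg (hk.nonneg z)])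
  have hi' : Integrable fun z => |g (x + -z)| * k (-z) := hi.comp_neg
  have h1 : ∫ z, |g (x + z)| * k z ≤ c * ∫ ξ, |g ξ * radialKernel q 1 ξ| := by
    rw [← integral_add_left_eq_self (fun ξ => |g ξ * radialKernel q 1 ξ|) x, ← integral_const_mul]
    exact integral_mono hi ((hgi.abs.comp_add_left x).const_mul c) hk.abs_mul_le
  have h2 : ∫ z, |g (x + -z)| * k (-z) = ∫ z, |g (x + z)| * k z :=
    integral_neg_eq_self (fun z => |g (x + z)| * k z) volume
  have h3 : ∫ z, k z ≤ c * ∫ ξ : EuclideanSpace ℝ (Fin N), radialKernel q 1 ξ := by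
    rw [← integral_add_left_eq_self (fun ξ => radialKernel q 1 ξ) x, ← integral_const_mul]
    exact integral_mono (hk.integrable hq)
      (((integrable_radialKernel_one hq).comp_add_left x).const_mul c) hk.le
  have h4 : ∫ z, |secondDiff g x z| * k z ≤
      ∫ z, (|g (x + z)| * k z + |g (x + -z)| * k (-z) + 2 * |g x| * k z) := by
    refine integral_mono ?_ ((hi.add hi').add ((hk.integrable hq).const_mul _)) fun z => ?_
    · exact (hk.integrable_secondDiff_mul hq hg hgi).abs.congr
        (ae_of_all _ fun z => by simp [abs_mul, abs_of_nonneg (hk.nonneg z)])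
    · dsimp only
      rw [hk.even, ← add_mul, ← add_mul, ← sub_eq_add_neg]
      refine mul_le_mul_of_nonneg_right ?_ (hk.nonneg z)
      have h5 := abs_sub (g (x + z) + g (x - z)) (2 * g x)
      have h6 := abs_add_le (g (x + z)) (g (x - z))
      rw [abs_mul, abs_two] at h5
      unfold secondDiff
      linarith
  have hadd : Integrable fun z => |g (x + z)| * k z + |g (x + -z)| * k (-z) := hi.add hi'
  rw [integral_add hadd ((hk.integrable hq).const_mul _), integral_add hi hi', h2,
    integral_const_mul] at h4
  nlinarith [mul_le_mul_of_nonneg_left h3 (abs_nonneg (g x))]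

end IsDominatedKernel

end SecondDiff

/-! ### Convergence of the regularized integrals and its rate -/

section Estimates

variable {N : ℕ} {σ y : ℝ} {g : EuclideanSpace ℝ (Fin N) → ℝ} {x : EuclideanSpace ℝ (Fin N)}

/-- At z = 0 the kernels alone do not compare, as `radialKernel q 0 0` is 0 by the convention on
inverses; the second difference vanishes there. -/
theorem abs_secondDiff_mul_radialKernel_le {q : ℝ} (hq : 0 < q) (z : EuclideanSpace ℝ (Fin N)) :
    |secondDiff g x z| * radialKernel q y z ≤ |secondDiff g x z| * radialKernel q 0 z := by
  rcases eq_or_ne z 0 with rfl | hz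
  · simp [secondDiff_zero]
  · exact mul_le_mul_of_nonneg_left (radialKernel_le hq hz) (abs_nonneg _)

theorem exists_abs_secondDiff_le (hg : ContDiff ℝ 2 g) (R : ℝ) :
    ∃ M, 0 ≤ M ∧ ∀ x : EuclideanSpace ℝ (Fin N), ‖x‖ ≤ R → |g x| ≤ M ∧
      ∀ z, ‖z‖ ≤ 1 → |secondDiff g x z| ≤ M * ‖z‖ ^ 2 := by
  have hc : Continuous (iteratedFDeriv ℝ 2 g) := hg.continuous_iteratedFDeriv (by norm_num)
  obtain ⟨M₁, hM₁⟩ := (isCompact_closedBall (0 : EuclideanSpace ℝ (Fin N))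
    (R + 1)).exists_bound_of_continuousOn hc.continuousOn
  obtain ⟨M₂, hM₂⟩ := (isCompact_closedBall (0 : EuclideanSpace ℝ (Fin N))
    R).exists_bound_of_continuousOn hg.continuous.continuousOn
  refine ⟨max (max (2 * M₁) M₂) 0, le_max_right _ _, fun x hx => ⟨?_, fun z hz => ?_⟩⟩
  · exact (hM₂ x (by simpa using hx)).trans ((le_max_right _ _).trans (le_max_left _ _))
  · refine (abs_secondDiff_le hg fun w hw => hM₁ w ?_).trans (mul_le_mul_of_nonneg_right
      ((le_max_left _ _).trans (le_max_left _ _)) (sq_nonneg _))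
    rw [mem_closedBall_zero_iff]
    rw [mem_closedBall_iff_norm] at hw
    have := norm_add_le x (w - x)
    rw [add_sub_cancel] at this
    linarith

theorem abs_secondDiff_mul_indicator {k : EuclideanSpace ℝ (Fin N) → ℝ} (hk : ∀ z, 0 ≤ k z)
    (S : Set (EuclideanSpace ℝ (Fin N))) (z : EuclideanSpace ℝ (Fin N)) :
    ‖secondDiff g x z * S.indicator k z‖ = |secondDiff g x z| * S.indicator k z := by
  rw [norm_mul, Real.norm_eq_abs, Real.norm_of_nonneg (indicator_nonneg (fun z _ => hk z) z)]

/-- The second difference is absolutely integrable against `|z|^(-(N+σ))`. -/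
theorem integrable_secondDiff_mul_radialKernel_zero (hN : 1 ≤ N) (hσ : σ ∈ Ioo (0 : ℝ) 2)
    (hg : ContDiff ℝ 2 g) (hgi : Integrable fun ξ => g ξ * radialKernel ((N + σ) / 2) 1 ξ)
    (x : EuclideanSpace ℝ (Fin N)) :
    Integrable fun z => secondDiff g x z * radialKernel ((N + σ) / 2) 0 z := by
  have hq : 0 < (N + σ) / 2 := by have := hσ.1; positivity
  obtain ⟨M, hM0, hM⟩ := exists_abs_secondDiff_le hg ‖x‖
  have h1 := (isDominatedKernel_indicator hq one_pos x).integrable_secondDiff_mul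
    (by linarith [hσ.1]) hg.continuous hgi
  -- The first majorant handles |z| ≤ 1 by the quadratic bound, the second |z| > 1 by the weighted
  -- integrability of g.
  refine Integrable.mono' (((integrable_min_sq_mul_radialKernel hN hσ).const_mul M).add h1.norm)
    ((measurable_secondDiff hg.continuous).mul measurable_radialKernel).aestronglyMeasurable
    (ae_of_all _ fun z => ?_)
  have hk := radialKernel_nonneg (q := (N + σ) / 2) (y := 0) z
  rw [Pi.add_apply, abs_secondDiff_mul_indicator radialKernel_nonneg, norm_mul, Real.norm_eq_abs,
    Real.norm_of_nonneg hk]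
  by_cases hz : 1 < ‖z‖
  · rw [indicator_of_mem (show z ∈ {z | 1 < ‖z‖} from hz)]
    have : 0 ≤ M * (min (‖z‖ ^ 2) 1 * radialKernel ((N + σ) / 2) 0 z) := by positivity
    linarith
  · have hz' := not_lt.1 hz
    rw [indicator_of_notMem (show z ∉ {z | 1 < ‖z‖} from hz), mul_zero, add_zero,
      min_eq_left (pow_le_one₀ (norm_nonneg z) hz'), ← mul_assoc]
    exact mul_le_mul_of_nonneg_right ((hM x le_rfl).2 z hz') hk

/-- Lets the far part obey the rate for every y > 0: the entry y² suffices for y ≤ 1, the entry s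
for y ≥ 1. -/
theorem min_sq_le_mul_rpow (hσ : σ ∈ Ioo (0 : ℝ) 2) (hy : 0 < y) {s : ℝ} (hs : 1 ≤ s) :
    min s (y ^ 2) ≤ s * y ^ (2 - σ) := by
  obtain ⟨h0, h2⟩ := hσ
  rcases le_total y 1 with h | h
  · have : y ^ 2 ≤ y ^ (2 - σ) := by
      rw [← Real.rpow_natCast]
      exact Real.rpow_le_rpow_of_exponent_ge hy h (by push_cast; linarith)
    have h3 : 0 < y ^ (2 - σ) := by positivity
    exact (min_le_right _ _).trans (by nlinarith)
  · have := Real.one_le_rpow h (show 0 ≤ 2 - σ by linarith)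
    exact (min_le_left _ _).trans (by nlinarith)

/-- The regularized integrals converge at rate `y^(2-σ)`; the quadratic bound on the second
difference is required only off a set `S` that stays away from the origin. -/
theorem abs_integral_secondDiff_sub_le (hN : 1 ≤ N) (hσ : σ ∈ Ioo (0 : ℝ) 2)
    (hg : ContDiff ℝ 2 g) (hgi : Integrable fun ξ => g ξ * radialKernel ((N + σ) / 2) 1 ξ)
    {M : ℝ} (hM0 : 0 ≤ M) {S : Set (EuclideanSpace ℝ (Fin N))} (hS : MeasurableSet S)
    (hS1 : ∀ z ∈ S, 1 ≤ ‖z‖) (hM : ∀ z ∉ S, |secondDiff g x z| ≤ M * ‖z‖ ^ 2) (hy : 0 < y) :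
    |(∫ z, secondDiff g x z * radialKernel ((N + σ) / 2) y z) -
        ∫ z, secondDiff g x z * radialKernel ((N + σ) / 2) 0 z| ≤
      (1 + (N + σ) / 2) * y ^ (2 - σ) *
        (M * (∫ z : EuclideanSpace ℝ (Fin N), min (‖z‖ ^ 2) 1 * radialKernel ((N + σ) / 2) 0 z) +
          ∫ z, |secondDiff g x z| * S.indicator (radialKernel ((N + σ) / 2) 0) z) := by
  set q : ℝ := (N + σ) / 2 with hqdef
  have hq : 0 < q := by have := hσ.1; positivity
  have hNq : (N : ℝ) < 2 * q := by linarith [hσ.1]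
  have hi0 := integrable_secondDiff_mul_radialKernel_zero hN hσ hg hgi x
  rw [← hqdef] at hi0
  have hiy := (isDominatedKernel_radialKernel hq hy x).integrable_secondDiff_mul hNq
    hg.continuous hgi
  have hiS : Integrable fun z => |secondDiff g x z| * S.indicator (radialKernel q 0) z := by
    refine (hi0.norm.indicator hS).congr (ae_of_all _ fun z => ?_)
    by_cases hz : z ∈ S <;> simp [hz, abs_of_nonneg (radialKernel_nonneg z)]
  have hiL := integrable_min_sq_mul_radialKernel_of_pos hN hσ hy
  rw [← hqdef] at hiL
  rw [← integral_sub hiy hi0, ← Real.norm_eq_abs]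
  have hY : 0 < y ^ (2 - σ) := by positivity
  calc _ ≤ ∫ z, ((1 + q) * M * (min (‖z‖ ^ 2) (y ^ 2) * radialKernel q 0 z) +
        (1 + q) * y ^ (2 - σ) * (|secondDiff g x z| * S.indicator (radialKernel q 0) z)) := by
        refine norm_integral_le_of_norm_le ((hiL.const_mul _).add (hiS.const_mul _))
          (ae_of_all _ fun z => ?_)
        have hk := radialKernel_nonneg (q := q) (y := 0) z
        have hnn : 0 ≤ (1 + q) * M * (min (‖z‖ ^ 2) (y ^ 2) * radialKernel q 0 z) := by positivity
        rcases eq_or_ne z 0 with rfl | hz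
        · simpa [secondDiff_zero] using hnn
        have hle := radialKernel_le (y := y) hq hz
        have hd := radialKernel_zero_sub_le (y := y) hq hz
        have hz0 : 0 < ‖z‖ ^ 2 := by have := norm_pos_iff.2 hz; positivity
        rw [← mul_sub, norm_mul, Real.norm_eq_abs, norm_sub_rev, Real.norm_of_nonneg (by linarith)]
        by_cases hzS : z ∈ S
        · rw [indicator_of_mem hzS]
          have h1 : 1 ≤ ‖z‖ ^ 2 := one_le_pow₀ (hS1 z hzS)
          have h2 : radialKernel q 0 z - radialKernel q y z ≤
              (1 + q) * y ^ (2 - σ) * radialKernel q 0 z := by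
            -- Cancelling |z|² leaves a bound that needs no growth control on the second difference.
            refine le_of_mul_le_mul_left (hd.trans ?_) hz0
            have h3 := mul_le_mul_of_nonneg_right (min_sq_le_mul_rpow hσ hy h1) hk
            have h4 := mul_le_mul_of_nonneg_left h3 (show 0 ≤ 1 + q by positivity)
            linarith
          have h5 := mul_le_mul_of_nonneg_left h2 (abs_nonneg (secondDiff g x z))
          linarith
        · rw [indicator_of_notMem hzS, mul_zero, mul_zero, add_zero]
          have h1 := mul_le_mul_of_nonneg_right (hM z hzS)
            (show 0 ≤ radialKernel q 0 z - radialKernel q y z by linarith)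
          have h2 := mul_le_mul_of_nonneg_left hd hM0
          linarith
    _ = _ := by
        rw [integral_add (hiL.const_mul _) (hiS.const_mul _), integral_const_mul,
          integral_const_mul, hqdef, integral_min_sq_mul_radialKernel hy]
        ring

/-- Translate by x, subtract g(x) times the unit mass of the kernel, and symmetrize. -/
theorem extension_eq (hσ : 0 < σ) (hg : Continuous g)
    (hgi : Integrable fun ξ => g ξ * radialKernel ((N + σ) / 2) 1 ξ) (hy : 0 < y) :
    extension σ g x y = g x + poissonConst N σ / 2 *
      (y ^ σ * ∫ z, secondDiff g x z * radialKernel ((N + σ) / 2) y z) := by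
  have hq : 0 < (N + σ) / 2 := by positivity
  have hNq : (N : ℝ) < 2 * ((N + σ) / 2) := by linarith
  have hk := isDominatedKernel_radialKernel hq hy x
  rw [extension, if_pos hy, hk.integral_secondDiff_mul hNq hg hgi,
    ← integral_add_left_eq_self _ x]
  have h1 : ∀ z : EuclideanSpace ℝ (Fin N), poissonKernel σ (x - (x + z)) y * g (x + z) =
      poissonConst N σ * y ^ σ * (g (x + z) * radialKernel ((N + σ) / 2) y z) := fun z => by
    rw [sub_add_cancel_left, poissonKernel, norm_neg, radialKernel]
    ring
  simp only [h1, sub_mul]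
  rw [integral_const_mul, integral_sub (hk.integrable_mul hg hgi) ((hk.integrable hNq).const_mul _),
    integral_const_mul]
  linear_combination (g x) * poissonConst_mul_rpow_mul_integral (N := N) hσ hy

/-! ### Limits, the derivative in y, and the principal value -/

theorem tendsto_integral_secondDiff {κ : ℝ → EuclideanSpace ℝ (Fin N) → ℝ}
    {κ₀ : EuclideanSpace ℝ (Fin N) → ℝ} {q : ℝ} (hg : Continuous g)
    (hi : Integrable fun z => secondDiff g x z * radialKernel q 0 z)
    (hm : ∀ y, Measurable (κ y))
    (hle : ∀ y, 0 < y → ∀ z ≠ 0, |κ y z| ≤ radialKernel q 0 z)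
    (hlim : ∀ z ≠ 0, Tendsto (fun y => κ y z) (𝓝[>] 0) (𝓝 (κ₀ z))) :
    Tendsto (fun y => ∫ z, secondDiff g x z * κ y z) (𝓝[>] 0)
      (𝓝 (∫ z, secondDiff g x z * κ₀ z)) := by
  refine tendsto_integral_filter_of_dominated_convergence _
    (Eventually.of_forall fun y =>
      ((measurable_secondDiff hg).mul (hm y)).aestronglyMeasurable) ?_ hi.norm
    (ae_of_all _ fun z => ?_)
  · filter_upwards [self_mem_nhdsWithin] with y hy
    refine ae_of_all _ fun z => ?_
    rcases eq_or_ne z 0 with rfl | hz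
    · simp [secondDiff_zero]
    · rw [norm_mul, norm_mul, Real.norm_of_nonneg (radialKernel_nonneg z)]
      exact mul_le_mul_of_nonneg_left (hle y hy z hz) (norm_nonneg _)
  · rcases eq_or_ne z 0 with rfl | hz
    · simp [secondDiff_zero]
    · exact (hlim z hz).const_mul _

theorem continuous_radialKernel {q : ℝ} {z : EuclideanSpace ℝ (Fin N)} (hz : z ≠ 0) :
    Continuous fun y => radialKernel q y z := by
  have : 0 < ‖z‖ := norm_pos_iff.2 hz
  unfold radialKernel
  refine Continuous.inv₀ (Continuous.rpow_const (by fun_prop) fun y => Or.inl ?_) fun y => ?_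
  · positivity
  · positivity

theorem hasDerivAt_radialKernel (q : ℝ) (hy : 0 < y) (z : EuclideanSpace ℝ (Fin N)) :
    HasDerivAt (fun y => radialKernel q y z) (-(2 * q * y) * radialKernel (q + 1) y z) y := by
  have hs : 0 < ‖z‖ ^ 2 + y ^ 2 := by positivity
  have h1 : HasDerivAt (fun y : ℝ => ‖z‖ ^ 2 + y ^ 2) (2 * y) y := by
    simpa using (hasDerivAt_pow 2 y).const_add (‖z‖ ^ 2)
  have h2 := h1.rpow_const (p := -q) (Or.inl hs.ne')
  have h3 : (fun y => radialKernel q y z) = fun y => (‖z‖ ^ 2 + y ^ 2) ^ (-q) := by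
    ext y
    rw [radialKernel, Real.rpow_neg (by positivity)]
  rw [h3]
  convert! h2 using 1
  rw [radialKernel, ← Real.rpow_neg hs.le, show -(q + 1) = -q - 1 by ring]
  ring

/-- Keeps the y-derivative of the kernel, of order q + 1, under the order-q kernel. -/
theorem sq_mul_radialKernel_add_one_le (q : ℝ) (hy : 0 < y) (z : EuclideanSpace ℝ (Fin N)) :
    y ^ 2 * radialKernel (q + 1) y z ≤ radialKernel q y z := by
  have hs : 0 < ‖z‖ ^ 2 + y ^ 2 := by positivity
  have h : radialKernel q y z = (‖z‖ ^ 2 + y ^ 2) * radialKernel (q + 1) y z := by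
    rw [radialKernel, radialKernel, Real.rpow_add_one hs.ne']
    field_simp
  rw [h]
  exact mul_le_mul_of_nonneg_right (by linarith [sq_nonneg ‖z‖]) (radialKernel_nonneg z)

theorem hasDerivAt_integral_secondDiff {q : ℝ} (hq : 0 < q) (hg : Continuous g)
    (hi : Integrable fun z => secondDiff g x z * radialKernel q 0 z) (hy : 0 < y) :
    HasDerivAt (fun y => ∫ z, secondDiff g x z * radialKernel q y z)
      (∫ z, secondDiff g x z * (-(2 * q * y) * radialKernel (q + 1) y z)) y := by
  have hm : ∀ {q' y' : ℝ}, AEStronglyMeasurable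
      (fun z => secondDiff g x z * radialKernel q' y' z) volume :=
    ((measurable_secondDiff hg).mul measurable_radialKernel).aestronglyMeasurable
  refine (hasDerivAt_integral_of_dominated_loc_of_deriv_le
    (F := fun y z => secondDiff g x z * radialKernel q y z)
    (F' := fun y z => secondDiff g x z * (-(2 * q * y) * radialKernel (q + 1) y z))
    -- For t > y/2, the order q + 1 kernel times 2qt is at most (2q/t) k_t, and 1/t < 2/y.
    (bound := fun z => 2 * q * (2 / y) * ‖secondDiff g x z * radialKernel q 0 z‖)
    (Ioi_mem_nhds (half_lt_self hy)) (Eventually.of_forall fun _ => hm) ?_ ?_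
    (ae_of_all _ fun z t ht => ?_) (hi.norm.const_mul _) (ae_of_all _ fun z t ht => ?_)).2
  · refine hi.norm.mono' hm (ae_of_all _ fun z => ?_)
    simp only [norm_mul, Real.norm_eq_abs, abs_of_nonneg (radialKernel_nonneg z)]
    exact abs_secondDiff_mul_radialKernel_le hq z
  · exact ((measurable_secondDiff hg).mul
      (measurable_radialKernel.const_mul _)).aestronglyMeasurable
  · have ht' : y / 2 < t := ht
    have ht0 : 0 < t := by linarith
    have hk := radialKernel_nonneg (q := q + 1) (y := t) z
    simp only [norm_mul, norm_neg, Real.norm_eq_abs, abs_of_nonneg (radialKernel_nonneg z)]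
    rw [abs_of_pos ht0, abs_of_pos hq, abs_two]
    have h1 : t * radialKernel (q + 1) t z ≤ 2 / y * radialKernel q t z := by
      have h2 := sq_mul_radialKernel_add_one_le q ht0 z
      rw [div_mul_eq_mul_div, le_div_iff₀ hy]
      nlinarith [mul_nonneg ht0.le hk]
    have h3 := mul_le_mul_of_nonneg_left h1
      (mul_nonneg (mul_nonneg zero_le_two hq.le) (abs_nonneg (secondDiff g x z)))
    have h4 := mul_le_mul_of_nonneg_left
      (abs_secondDiff_mul_radialKernel_le (g := g) (x := x) (y := t) hq z)
      (show 0 ≤ 2 * q * (2 / y) by positivity)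
    linarith
  · have ht' : y / 2 < t := ht
    exact (hasDerivAt_radialKernel q (by linarith) z).const_mul _

/-- The product rule on y^σ I(y) gives two terms: σ I(y) produces the limit, while y I'(y) carries
y² times the order q + 1 kernel, which tends to 0 off the origin under the majorant k_0. -/
theorem hasSigmaDeriv_extension (hN : 1 ≤ N) (hσ : σ ∈ Ioo (0 : ℝ) 2)
    (hg : ContDiff ℝ 2 g) (hgi : Integrable fun ξ => g ξ * radialKernel ((N + σ) / 2) 1 ξ)
    (x : EuclideanSpace ℝ (Fin N)) :
    HasSigmaDeriv σ (extension σ g) x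
      (fracConst N σ / 2 * ∫ z, secondDiff g x z * radialKernel ((N + σ) / 2) 0 z) := by
  set q : ℝ := (N + σ) / 2 with hqdef
  have hq : 0 < q := by have := hσ.1; positivity
  have hi := integrable_secondDiff_mul_radialKernel_zero hN hσ hg hgi x
  have hderiv : ∀ y, 0 < y → HasDerivAt (extension σ g x) (poissonConst N σ / 2 *
      (σ * y ^ (σ - 1) * (∫ z, secondDiff g x z * radialKernel q y z) +
        y ^ σ * ∫ z, secondDiff g x z * (-(2 * q * y) * radialKernel (q + 1) y z))) y :=
    fun y hy => by
      have h1 := ((Real.hasDerivAt_rpow_const (p := σ) (Or.inl hy.ne')).mul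
        (hasDerivAt_integral_secondDiff hq hg.continuous hi hy)).const_mul (poissonConst N σ / 2)
      refine (h1.const_add (g x)).congr_of_eventuallyEq ?_
      filter_upwards [Ioi_mem_nhds hy] with t ht
      exact extension_eq hσ.1 hg.continuous hgi ht
  refine ⟨fun y hy => (hderiv y hy).differentiableAt, ?_⟩
  have hlim1 : Tendsto (fun y => ∫ z, secondDiff g x z * radialKernel q y z) (𝓝[>] 0)
      (𝓝 (∫ z, secondDiff g x z * radialKernel q 0 z)) := by
    refine tendsto_integral_secondDiff hg.continuous hi (fun y => measurable_radialKernel)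
      (fun y hy z hz => ?_) fun z hz =>
        ((continuous_radialKernel hz).tendsto 0).mono_left nhdsWithin_le_nhds
    rw [abs_of_nonneg (radialKernel_nonneg z)]
    exact radialKernel_le hq hz
  have hlim2 : Tendsto (fun y => ∫ z, secondDiff g x z * (y ^ 2 * radialKernel (q + 1) y z))
      (𝓝[>] 0) (𝓝 0) := by
    have := tendsto_integral_secondDiff (x := x) (κ₀ := fun _ => 0)
      (κ := fun y z => y ^ 2 * radialKernel (q + 1) y z) hg.continuous hi
      (fun y => measurable_radialKernel.const_mul _) (fun y hy z hz => ?_) fun z hz => ?_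
    · simpa using this
    · rw [abs_of_nonneg (mul_nonneg (sq_nonneg y) (radialKernel_nonneg z))]
      exact (sq_mul_radialKernel_add_one_le q hy z).trans (radialKernel_le hq hz)
    · have h : Continuous fun y : ℝ => y ^ 2 * radialKernel (q + 1) y z :=
        (continuous_pow 2).mul (continuous_radialKernel hz)
      simpa using (h.tendsto 0).mono_left (nhdsWithin_le_nhds (s := Ioi 0))
  have hlim := (hlim1.const_mul (fracConst N σ / 2)).add
    (hlim2.const_mul (-(mu σ * poissonConst N σ * q)))
  rw [mul_zero, add_zero] at hlim
  refine hlim.congr' ?_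
  filter_upwards [self_mem_nhdsWithin] with y hy
  have hy' : 0 < y := hy
  have e1 : y ^ (1 - σ) * y ^ (σ - 1) = 1 := by
    rw [← Real.rpow_add hy']; simp
  have e2 : y ^ (1 - σ) * y ^ σ = y := by
    rw [← Real.rpow_add hy']; simp
  have e3 : ∫ z, secondDiff g x z * (-(2 * q * y) * radialKernel (q + 1) y z) =
      -(2 * q * y) * ∫ z, secondDiff g x z * radialKernel (q + 1) y z := by
    rw [← integral_const_mul]
    congr 1 with z
    ring
  have e4 : ∫ z, secondDiff g x z * (y ^ 2 * radialKernel (q + 1) y z) =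
      y ^ 2 * ∫ z, secondDiff g x z * radialKernel (q + 1) y z := by
    rw [← integral_const_mul]
    congr 1 with z
    ring
  rw [(hderiv y hy').deriv, e3, e4, ← mu_mul_poissonConst hσ.1]
  generalize (∫ z, secondDiff g x z * radialKernel (q + 1) y z) = I₁
  generalize (∫ z, secondDiff g x z * radialKernel q y z) = I₀
  linear_combination (-(mu σ * poissonConst N σ / 2 * σ * I₀)) * e1 +
    (mu σ * poissonConst N σ * q * y * I₁) * e2

/-- The truncated kernel is even, so each truncated integral equals -1/2 times one of the second
difference, where dominated convergence applies. -/
theorem hasFracLaplacian (hN : 1 ≤ N) (hσ : σ ∈ Ioo (0 : ℝ) 2)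
    (hg : ContDiff ℝ 2 g) (hgi : Integrable fun ξ => g ξ * radialKernel ((N + σ) / 2) 1 ξ)
    (x : EuclideanSpace ℝ (Fin N)) :
    HasFracLaplacian σ g x
      (-(fracConst N σ / 2 * ∫ z, secondDiff g x z * radialKernel ((N + σ) / 2) 0 z)) := by
  set q : ℝ := (N + σ) / 2 with hqdef
  have hq : 0 < q := by have := hσ.1; positivity
  have hNq : (N : ℝ) < 2 * q := by linarith [hσ.1]
  have hi := integrable_secondDiff_mul_radialKernel_zero hN hσ hg hgi x
  have hmeas : ∀ ε : ℝ, MeasurableSet {ξ | ε < ‖x - ξ‖} := fun ε =>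
    measurableSet_lt measurable_const (by fun_prop)
  have htrans : ∀ ε : ℝ, ∀ z, {ξ | ε < ‖x - ξ‖}.indicator
      (fun ξ => (g x - g ξ) / ‖x - ξ‖ ^ ((N : ℝ) + σ)) (x + z) =
      -((g (x + z) - g x) * {z | ε < ‖z‖}.indicator (radialKernel q 0) z) := fun ε z => by
    have h2q : 2 * q = N + σ := by rw [hqdef]; ring
    by_cases hz : ε < ‖z‖
    · rw [indicator_of_mem (by simpa using hz), indicator_of_mem (by simpa using hz),
        radialKernel_zero, sub_add_cancel_left, norm_neg, h2q]
      ring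
    · rw [indicator_of_notMem (by simpa using hz), indicator_of_notMem (by simpa using hz)]
      ring
  refine ⟨fun ε hε => ?_, ?_⟩
  · rw [← integrable_indicator_iff (hmeas ε)]
    have h := ((isDominatedKernel_indicator hq hε x).integrable_sub_mul hNq hg.continuous hgi).neg
    refine (h.comp_add_left (-x)).congr (ae_of_all _ fun ξ => ?_)
    have := htrans ε (-x + ξ)
    rw [add_neg_cancel_left] at this
    rw [this]
    simp
  · have hlim : Tendsto (fun ε : ℝ => ∫ z, secondDiff g x z *
        {z | ε < ‖z‖}.indicator (radialKernel q 0) z) (𝓝[>] 0)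
        (𝓝 (∫ z, secondDiff g x z * radialKernel q 0 z)) := by
      refine tendsto_integral_secondDiff hg.continuous hi
        (fun ε => measurable_radialKernel.indicator
          (measurableSet_lt measurable_const measurable_norm)) (fun ε _ z _ => ?_) fun z hz => ?_
      · rw [abs_of_nonneg (indicator_nonneg (fun z _ => radialKernel_nonneg z) z)]
        exact indicator_le_self' (fun _ _ => radialKernel_nonneg z) z
      · refine tendsto_const_nhds.congr' ?_
        filter_upwards [nhdsWithin_le_nhds (Iio_mem_nhds (norm_pos_iff.2 hz))] with ε hε
        rw [indicator_of_mem (show z ∈ {z | ε < ‖z‖} from hε)]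
    have hlim' := hlim.const_mul (-(fracConst N σ / 2))
    rw [neg_mul] at hlim'
    refine hlim'.congr' ?_
    filter_upwards [self_mem_nhdsWithin] with ε hε
    rw [(isDominatedKernel_indicator hq hε x).integral_secondDiff_mul hNq hg.continuous hgi,
      ← integral_indicator (hmeas ε),
      ← integral_add_left_eq_self ({ξ | ε < ‖x - ξ‖}.indicator _) x]
    simp only [htrans]
    rw [integral_neg]
    ring

theorem abs_mu_mul_twoPoint_sub (hσ : 0 < σ) (hg : Continuous g)
    (hgi : Integrable fun ξ => g ξ * radialKernel ((N + σ) / 2) 1 ξ) (hy : 0 < y) (I : ℝ) :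
    |mu σ * twoPoint σ (extension σ g) x y - fracConst N σ / 2 * I| =
      |fracConst N σ| / 2 *
        |(∫ z, secondDiff g x z * radialKernel ((N + σ) / 2) y z) - I| := by
  have h0 : extension σ g x 0 = g x := by simp [extension]
  have hyσ : y ^ σ ≠ 0 := by positivity
  rw [twoPoint, h0, extension_eq hσ hg hgi hy, ← mu_mul_poissonConst hσ, ← abs_two (α := ℝ),
    ← abs_div, ← abs_mul, abs_two]
  congr 1
  field_simp
  ring

end Estimates

end SigmaExtension

/-- The weighted integrability of `g` says exactly that its Poisson integral converges absolutely;
it holds for every bounded `g`. -/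
theorem mainTheorem1 (N : ℕ) (hN : 1 ≤ N) (σ : ℝ) (hσ : σ ∈ Set.Ioo (0 : ℝ) 2) :
    ∃ C : ℝ, ∀ g : EuclideanSpace ℝ (Fin N) → ℝ, ContDiff ℝ 2 g →
      Integrable (fun ξ => g ξ / (‖ξ‖ ^ 2 + 1) ^ (((N : ℝ) + σ) / 2)) →
      ∃ D : EuclideanSpace ℝ (Fin N) → ℝ,
        -- `D x` is the normalized `σ`-derivative at `(x,0)`, and equals `-(-Δ)^(σ/2) g (x)`
        (∀ x, SigmaExtension.HasSigmaDeriv σ (SigmaExtension.extension σ g) x (D x)) ∧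
        (∀ x, SigmaExtension.HasFracLaplacian σ g x (-D x)) ∧
        -- error `O(y^(2-σ))`, locally uniformly in `x`
        (∀ K : Set (EuclideanSpace ℝ (Fin N)), IsCompact K →
          ∃ A : ℝ, ∀ x ∈ K, ∀ y : ℝ, 0 < y →
            |SigmaExtension.mu σ *
                SigmaExtension.twoPoint σ (SigmaExtension.extension σ g) x y - D x|
              ≤ A * y ^ (2 - σ)) ∧
        -- error `O(y^(2-σ))`, uniformly in `x`, if `g` and its second derivative are bounded
        (∀ M : ℝ, (∀ x, |g x| ≤ M) → (∀ x, ‖iteratedFDeriv ℝ 2 g x‖ ≤ M) →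
          ∀ (x : EuclideanSpace ℝ (Fin N)) (y : ℝ), 0 < y →
            |SigmaExtension.mu σ *
                SigmaExtension.twoPoint σ (SigmaExtension.extension σ g) x y - D x|
              ≤ C * M * y ^ (2 - σ)) := by
  have hNq : (N : ℝ) < 2 * ((N + σ) / 2) := by linarith [hσ.1]
  have hq : 0 < ((N : ℝ) + σ) / 2 := by have := hσ.1; positivity
  set J := ∫ z : EuclideanSpace ℝ (Fin N),
    min (‖z‖ ^ 2) 1 * SigmaExtension.radialKernel ((N + σ) / 2) 0 z with hJ
  set c := |SigmaExtension.fracConst N σ| / 2 with hc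
  have hc0 : 0 ≤ c := by positivity
  -- Here c is the prefactor |C_{N,σ}|/2, 1 + (N+σ)/2 comes from the kernel comparison, 2 from
  -- `abs_secondDiff_le`, and J from scaling.
  refine ⟨c * ((1 + (N + σ) / 2) * (2 * J)), fun g hg hgi' => ?_⟩
  have hgi : Integrable fun ξ => g ξ * SigmaExtension.radialKernel ((N + σ) / 2) 1 ξ := by
    simpa [SigmaExtension.radialKernel, div_eq_mul_inv] using hgi'
  refine ⟨fun x => SigmaExtension.fracConst N σ / 2 *
      ∫ z, SigmaExtension.secondDiff g x z * SigmaExtension.radialKernel ((N + σ) / 2) 0 z,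
    SigmaExtension.hasSigmaDeriv_extension hN hσ hg hgi,
    SigmaExtension.hasFracLaplacian hN hσ hg hgi, fun K hK => ?_, fun M hM hM2 x y hy => ?_⟩
  · obtain ⟨R, hR⟩ := hK.isBounded.exists_norm_le
    obtain ⟨M, hM0, hM⟩ := SigmaExtension.exists_abs_secondDiff_le hg R
    -- T bounds the tail over |z| > 1 uniformly for |x| ≤ R; the 1² is ε² from the truncation at ε =
    -- 1.
    set T := 2 * (2 + (2 * R ^ 2 + 1) / 1 ^ 2) ^ (((N : ℝ) + σ) / 2) *
      ((∫ ξ, |g ξ * SigmaExtension.radialKernel ((N + σ) / 2) 1 ξ|) +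
        M * ∫ ξ : EuclideanSpace ℝ (Fin N), SigmaExtension.radialKernel ((N + σ) / 2) 1 ξ) with hT
    refine ⟨c * ((1 + (N + σ) / 2) * (M * J + T)), fun x hx y hy => ?_⟩
    have hxR := hR x hx
    obtain ⟨hgx, hdiff⟩ := hM x hxR
    have h1 := SigmaExtension.abs_integral_secondDiff_sub_le (x := x) hN hσ hg hgi hM0
      (S := {z | 1 < ‖z‖}) (measurableSet_lt measurable_const measurable_norm)
      (fun z hz => le_of_lt hz) (fun z hz => hdiff z (not_lt.1 hz)) hy
    have h2 := (SigmaExtension.isDominatedKernel_indicator hq one_pos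
      x).integral_abs_secondDiff_mul_le hNq hg.continuous hgi
    have hK1 : 0 ≤ ∫ ξ : EuclideanSpace ℝ (Fin N),
        SigmaExtension.radialKernel ((N + σ) / 2) 1 ξ :=
      integral_nonneg SigmaExtension.radialKernel_nonneg
    have h3 : ∫ z, |SigmaExtension.secondDiff g x z| *
        {z | 1 < ‖z‖}.indicator (SigmaExtension.radialKernel ((N + σ) / 2) 0) z ≤ T := by
      refine h2.trans ?_
      rw [hT]
      gcongr
    rw [SigmaExtension.abs_mu_mul_twoPoint_sub hσ.1 hg.continuous hgi hy, ← hc, mul_assoc]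
    refine mul_le_mul_of_nonneg_left (h1.trans ?_) hc0
    rw [mul_right_comm]
    gcongr
  · have hM0 : 0 ≤ M := (abs_nonneg _).trans (hM x)
    have h1 := SigmaExtension.abs_integral_secondDiff_sub_le (x := x) hN hσ hg hgi
      -- The quadratic bound is global, so the exceptional set is empty and no tail term appears.
      (M := 2 * M) (by positivity) (S := ∅) MeasurableSet.empty (fun z hz => hz.elim)
      (fun z _ => SigmaExtension.abs_secondDiff_le hg fun w _ => hM2 w) hy
    rw [SigmaExtension.abs_mu_mul_twoPoint_sub hσ.1 hg.continuous hgi hy, ← hc, mul_assoc,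
      mul_assoc]
    refine mul_le_mul_of_nonneg_left (h1.trans (le_of_eq ?_)) hc0
    simp only [Set.indicator_empty, mul_zero, integral_zero, add_zero, ← hJ]
    ring
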